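/- For positive integers $k \ge 2d$, a $(k,d)$-coloring of a graph $G$ is a map $f : V(G) \to \{0,1,\dots,k-1\}$ such that $d \le |f(x)-f(y)| \le k-d$ for every edge $xy$ of $G$. The circular chromatic number of $G$ is $\chi_c(G) = \inf\{k/d : G \text{ has a } (k,d)\text{-coloring}\}$. Let $P_L$ be the line graph of the Petersen graph. Then $\chi_c(P_L) = 11/3$. -/

import Mathlib

/-- The Petersen graph: its vertices are the ten 2-element subsets of a 5-element set, and two of
them are adjacent when they are disjoint. -/
def petersenGraph : SimpleGraph {s : Finset (Fin 5) // s.card = 2} where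
  Adj s t := Disjoint s.1 t.1
  symm := ⟨fun _ _ h => Disjoint.symm h⟩
  loopless := ⟨fun s h => by
    have h0 : s.1 = ∅ := Finset.disjoint_self_iff_empty _ |>.mp h
    have h2 := s.2
    simp [h0] at h2⟩

/-- `f` is a `(k, d)`-coloring of `G`: it maps the vertices to `{0, 1, …, k - 1}`, and the values at
the ends `x`, `y` of any edge satisfy `d ≤ |f x - f y| ≤ k - d` (computed in the integers). -/
def IsCircularColoring {V : Type*} (G : SimpleGraph V) (k d : ℕ) (f : V → Fin k) : Prop :=
  ∀ x y : V, G.Adj x y →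
    (d : ℤ) ≤ |((f x : ℕ) : ℤ) - ((f y : ℕ) : ℤ)| ∧
      |((f x : ℕ) : ℤ) - ((f y : ℕ) : ℤ)| ≤ (k : ℤ) - (d : ℤ)

/-- The circular chromatic number of `G`: the infimum of `k / d` over all positive integers `k`, `d`
with `k ≥ 2 d` such that `G` has a `(k, d)`-coloring. -/
noncomputable def circularChromaticNumber {V : Type*} (G : SimpleGraph V) : ℝ :=
  sInf {r : ℝ | ∃ k d : ℕ, 0 < d ∧ 2 * d ≤ k ∧ (∃ f : V → Fin k, IsCircularColoring G k d f) ∧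
    r = (k : ℝ) / (d : ℝ)}

/-!
Suppose that the line graph of the Petersen graph has a `(k, d)`-coloring with `3 k < 11 d`. A
uniformly random rotation of the colors gives each of the 15 edges a color below `d` with
probability `d / k`, so after some rotation at least five edges have such a color. These are
pairwise disjoint, hence form a perfect matching. The Petersen graph is 3-arc-transitive and a
perfect matching is determined by the two edges at the ends of a 3-arc, so every perfect matching
consists, up to an automorphism, of the five spokes joining the inner pentagon to the outer
pentagram.

The spokes have colors in a window of length `d`, so the colors along each of the two 5-cycles
that remain all lie above their spokes and, the cycle being odd, rise or fall by `d` twice in a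
row somewhere. With `p = 4 d - k`, this forces gaps of `p` between the colors of some spokes. The
gaps coming from the pentagon (step 1) and from the pentagram (step 2) fit together in a window of
length `d` only if `3 p ≤ d`, that is, `11 d ≤ 3 k`.
-/

open Finset
open scoped Fin.CommRing

namespace IsCircularColoring

variable {V : Type*} {G : SimpleGraph V} {k d : ℕ} {f : V → Fin k}

theorem isIndepSet_val_lt (hf : IsCircularColoring G k d f) :
    G.IsIndepSet {x | (f x : ℕ) < d} := by
  intro x (hx : (f x : ℕ) < d) y (hy : (f y : ℕ) < d) _ hxy
  have hdist := (hf x y hxy).1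
  rw [le_abs] at hdist
  omega

theorem add_right [NeZero k] (hf : IsCircularColoring G k d f) (c : Fin k) :
    IsCircularColoring G k d fun x => f x + c := by
  intro x y hxy
  have hdist := hf x y hxy
  simp only [Fin.val_add_eq_ite, le_abs, abs_le] at hdist ⊢
  split_ifs <;> omega

theorem val_mem_Icc_of_val_lt (hf : IsCircularColoring G k d f) {x y : V} (hxy : G.Adj x y)
    (hx : (f x : ℕ) < d) : ((f y : ℕ) : ℤ) ∈ Set.Icc ((f x : ℤ) + d) ((f x : ℤ) + (k - d)) := by
  have hdist := hf x y hxy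
  simp only [le_abs, abs_le] at hdist
  rw [Set.mem_Icc]
  omega

end IsCircularColoring

theorem card_filter_add_val_lt {k d : ℕ} [NeZero k] (hdk : d ≤ k) (a : Fin k) :
    #{c : Fin k | ((a + c : Fin k) : ℕ) < d} = d := by
  have : #{c : Fin k | (c : ℕ) < d} = d := by
    rw [Fin.card_filter_val_lt, min_eq_right hdk]
  calc #{c : Fin k | ((a + c : Fin k) : ℕ) < d} = #{c : Fin k | (c : ℕ) < d} :=
        card_equiv (Equiv.addLeft a) (by simp)
    _ = d := this

theorem exists_card_mul_le_mul_card_add_val_lt {α : Type*} [Fintype α] {k d : ℕ} [NeZero k]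
    (hdk : d ≤ k) (f : α → Fin k) :
    ∃ c, Fintype.card α * d ≤ k * #{x | ((f x + c : Fin k) : ℕ) < d} := by
  by_contra! h
  have hsum : ∑ c, #{x | ((f x + c : Fin k) : ℕ) < d} = Fintype.card α * d := by
    simp_rw [card_filter]
    rw [sum_comm]
    simp [card_filter_add_val_lt hdk]
  have := sum_lt_sum_of_nonempty univ_nonempty fun c (_ : c ∈ univ) => h c
  rw [← mul_sum, hsum] at this
  simp at this

section LineGraph

variable {V : Type*} {G : SimpleGraph V}

theorem lineGraph_adj_of_ne {u v w : V} (hu : G.Adj v u) (hw : G.Adj v w) (huw : u ≠ w) :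
    G.lineGraph.Adj ⟨s(v, u), hu⟩ ⟨s(v, w), hw⟩ := by
  rw [SimpleGraph.lineGraph_adj_iff_exists]
  exact ⟨fun h => huw (Sym2.congr_right.1 (congrArg Subtype.val h)), v, by simp, by simp⟩

theorem exists_mem_of_isIndepSet_lineGraph [Fintype V] {S : Finset G.edgeSet}
    (hS : G.lineGraph.IsIndepSet (S : Set G.edgeSet)) (hcard : Fintype.card V ≤ 2 * #S) (v : V) :
    ∃ e ∈ S, v ∈ (e : Sym2 V) := by
  classical
  have hdisj : (S : Set G.edgeSet).PairwiseDisjoint fun e => (e : Sym2 V).toFinset := by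
    intro e he e' he' hne
    refine Finset.disjoint_left.2 fun w hw hw' => hS he he' hne ?_
    exact SimpleGraph.lineGraph_adj_iff_exists.2
      ⟨hne, w, Sym2.mem_toFinset.1 hw, Sym2.mem_toFinset.1 hw'⟩
  have hcover : S.biUnion (fun e => (e : Sym2 V).toFinset) = univ := by
    refine eq_univ_of_card _ (le_antisymm (card_le_univ _) ?_)
    rw [card_biUnion hdisj, sum_congr rfl fun e _ =>
      Sym2.card_toFinset_of_not_isDiag _ (G.not_isDiag_of_mem_edgeSet e.2)]
    simpa [mul_comm] using hcard
  simpa using hcover.symm.subset (mem_univ v)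

theorem exists_involutive_of_isIndepSet_lineGraph [Fintype V]
    {S : Finset G.edgeSet} (hS : G.lineGraph.IsIndepSet (S : Set G.edgeSet))
    (hcard : Fintype.card V ≤ 2 * #S) :
    ∃ m : V → V, m.Involutive ∧ ∀ v, ∃ h : G.Adj v (m v), ⟨s(v, m v), h⟩ ∈ S := by
  classical
  have hpartner (v : V) : ∃ w, ∃ h : G.Adj v w, ⟨s(v, w), h⟩ ∈ S := by
    obtain ⟨⟨e, he⟩, heS, w, rfl⟩ := exists_mem_of_isIndepSet_lineGraph hS hcard v
    exact ⟨w, he, heS⟩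
  choose m hadj hmem using hpartner
  refine ⟨m, fun v => ?_, fun v => ⟨hadj v, hmem v⟩⟩
  by_contra! hne
  have hvm := lineGraph_adj_of_ne (hadj (m v)) (hadj v).symm hne
  refine hS (hmem (m v)) ?_ hvm.ne hvm
  simpa only [Sym2.eq_swap, mem_coe] using hmem v

end LineGraph

theorem exists_iff_add_of_odd_card {A : Type*} [AddGroup A] (hA : Odd (Nat.card A)) (P : A → Prop)
    (a : A) : ∃ x, P x ↔ P (x + a) := by
  by_contra! hflip
  have hiterate (n : ℕ) : P (n • a) ↔ (P 0 ↔ Even n) := by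
    induction n with
    | zero => simp
    | succ n ih =>
      have := hflip (n • a)
      rw [succ_nsmul, Nat.even_add_one]
      tauto
  have := hiterate (Nat.card A)
  rw [card_nsmul_eq_zero', ← Nat.not_odd_iff_even] at this
  tauto

/-- The inequalities satisfied by a `(k, d)`-coloring of the edges of a sun, that is, a 5-cycle with
one pendant edge (a spoke) at each vertex, when all spokes have colors below `d`. The vertices of
the cycle are indexed so that `i` is followed by `i + e`; `h i` is the color of the spoke at `i` and
`a i` that of the cycle edge from `i` to `i + e`. -/
structure IsSunColoring (k d : ℤ) (e : Fin 5) (h a : Fin 5 → ℤ) : Prop where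
  left_mem : ∀ i, a i ∈ Set.Icc (h i + d) (h i + (k - d))
  right_mem : ∀ i, a i ∈ Set.Icc (h (i + e) + d) (h (i + e) + (k - d))
  le_abs_sub : ∀ i, d ≤ |a i - a (i + e)|

/-- The inequalities between the spoke colors `h` of a sun that hold when the colors of its cycle
edges rise by `d` at `i` and again at `i + e`; here `p` stands for `4 d - k`. -/
structure IsAscent (p d : ℤ) (e : Fin 5) (h : Fin 5 → ℤ) (i : Fin 5) : Prop where
  zero_two : h i + p ≤ h (i + 2 * e)
  zero_three : h i + p ≤ h (i + 3 * e)
  one_two : h (i + e) + p ≤ h (i + 2 * e)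
  one_three : h (i + e) + p ≤ h (i + 3 * e)
  four_zero : h (i + 4 * e) + p ≤ h i + d
  three_four : h (i + 3 * e) + p ≤ h (i + 4 * e) + d

namespace IsSunColoring

variable {k d : ℤ} {e : Fin 5} {h a : Fin 5 → ℤ}

theorem reverse (hs : IsSunColoring k d e h a) :
    IsSunColoring k d (-e) h fun i => a (i - e) where
  left_mem i := by simpa using hs.right_mem (i - e)
  right_mem i := by simpa [← sub_eq_add_neg] using hs.left_mem (i - e)
  le_abs_sub i := by simpa [← sub_eq_add_neg, abs_sub_comm] using hs.le_abs_sub (i - e - e)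

theorem step_cases (hs : IsSunColoring k d e h a) (i : Fin 5) :
    a i + d ≤ a (i + e) ∨ a (i + e) + d ≤ a i := by
  have := hs.le_abs_sub i
  rw [le_abs] at this
  omega

theorem exists_two_rises_or_two_falls (hs : IsSunColoring k d e h a) :
    ∃ i, (a i + d ≤ a (i + e) ∧ a (i + e) + d ≤ a (i + 2 * e)) ∨
      (a (i + e) + d ≤ a i ∧ a (i + 2 * e) + d ≤ a (i + e)) := by
  have hodd : Odd (Nat.card (Fin 5)) := by
    rw [Nat.card_fin]
    decide
  obtain ⟨i, hi⟩ := exists_iff_add_of_odd_card hodd (fun i => a i + d ≤ a (i + e)) e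
  have step₀ := hs.step_cases i
  have step₁ := hs.step_cases (i + e)
  have hadd : i + e + e = i + 2 * e := by ring
  rw [hadd] at hi step₁
  exact ⟨i, by tauto⟩

theorem isAscent_of_two_rises (hs : IsSunColoring k d e h a) (hk : k < 4 * d)
    (hh : ∀ i j, h i < h j + d) {i : Fin 5} (h₁ : a i + d ≤ a (i + e))
    (h₂ : a (i + e) + d ≤ a (i + 2 * e)) :
    IsAscent (4 * d - k) d e h i := by
  have hcycle : ∀ i e : Fin 5, i + e + e = i + 2 * e ∧ i + 2 * e + e = i + 3 * e ∧
      i + 3 * e + e = i + 4 * e ∧ i + 4 * e + e = i := by decide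
  have l₀ := hs.left_mem i
  have r₀ := hs.right_mem i
  have l₁ := hs.left_mem (i + e)
  have r₁ := hs.right_mem (i + e)
  have l₂ := hs.left_mem (i + 2 * e)
  have r₂ := hs.right_mem (i + 2 * e)
  have l₃ := hs.left_mem (i + 3 * e)
  have r₃ := hs.right_mem (i + 3 * e)
  have l₄ := hs.left_mem (i + 4 * e)
  have r₄ := hs.right_mem (i + 4 * e)
  have s₂ := hs.step_cases (i + 2 * e)
  have s₃ := hs.step_cases (i + 3 * e)
  have s₄ := hs.step_cases (i + 4 * e)
  simp only [hcycle, Set.mem_Icc] at *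
  -- After two rises there is no room for a third, so the cycle goes: rise, rise, fall, rise, fall.
  have fall₂ : a (i + 3 * e) + d ≤ a (i + 2 * e) := by
    have := hh (i + 4 * e) i
    omega
  have fall₄ : a i + d ≤ a (i + 4 * e) := by
    have := hh (i + 3 * e) (i + 4 * e)
    omega
  have rise₃ : a (i + 3 * e) + d ≤ a (i + 4 * e) := by
    have := hh (i + 3 * e) i
    omega
  constructor <;> omega

theorem exists_isAscent (hs : IsSunColoring k d e h a) (hk : k < 4 * d)
    (hh : ∀ i j, h i < h j + d) :
    ∃ i, IsAscent (4 * d - k) d e h i ∨ IsAscent (4 * d - k) d (-e) h i := by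
  obtain ⟨i, ⟨h₁, h₂⟩ | ⟨h₁, h₂⟩⟩ := hs.exists_two_rises_or_two_falls
  · exact ⟨i, .inl (hs.isAscent_of_two_rises hk hh h₁ h₂)⟩
  · have hindex : ∀ i e : Fin 5, i + 3 * e - e = i + 2 * e ∧ i + 3 * e + -e - e = i + e ∧
        i + 3 * e + 2 * -e - e = i := by decide
    refine ⟨i + 3 * e, .inr (hs.reverse.isAscent_of_two_rises hk hh ?_ ?_)⟩ <;> simpa only [hindex]

end IsSunColoring

namespace IsAscent

variable {p d : ℤ} {h : Fin 5 → ℤ} {i j c e : Fin 5}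

theorem comp_affine (ha : IsAscent p d (e * c) h (i + e * j)) :
    IsAscent p d c (fun x => h (i + e * x)) j := by
  have hmul (n : Fin 5) : i + e * (j + n * c) = i + e * j + n * (e * c) := by ring
  have hadd : i + e * (j + c) = i + e * j + e * c := by ring
  obtain ⟨h₀₂, h₀₃, h₁₂, h₁₃, h₄₀, h₃₄⟩ := ha
  constructor <;> simpa only [hmul, hadd]

theorem three_mul_le_of_zero (hh : ∀ i j, h i < h j + d)
    (h₁ : IsAscent p d 1 h 0) (h₂ : IsAscent p d 2 h j ∨ IsAscent p d (-2) h j) : 3 * p ≤ d := by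
  have hd := hh 0 0
  rw [show (-2 : Fin 5) = 3 from rfl] at h₂
  -- In six of the ten positions of the second ascent, some spoke lies `p` below another in one
  -- ascent and `p` above it in the other, so `p ≤ 0`. In the other four, the second ascent
  -- compares `4` with `0` or `3`, which closes a cycle of inequalities through `0`, `3`, `4`.
  obtain ⟨_, _, _, _, _, _⟩ := h₁
  obtain ⟨_, _, _, _, _, _⟩ | ⟨_, _, _, _, _, _⟩ := h₂ <;> fin_cases j <;>
    simp only [Fin.zero_eta, Fin.mk_one, Fin.reduceFinMk, Fin.reduceAdd, Fin.reduceMul] at * <;>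
    omega

theorem three_mul_le (hh : ∀ i j, h i < h j + d)
    (h₁ : IsAscent p d 1 h i ∨ IsAscent p d (-1) h i)
    (h₂ : IsAscent p d 2 h j ∨ IsAscent p d (-2) h j) : 3 * p ≤ d := by
  obtain ⟨e, he, h₁⟩ : ∃ e : Fin 5, (e = 1 ∨ e = -1) ∧ IsAscent p d e h i := by
    simpa [or_and_right, exists_or] using h₁
  have hj : ∀ e i j : Fin 5, e = 1 ∨ e = -1 → j = i + e * (e * (j - i)) := by decide
  rw [hj e i j he] at h₂
  refine three_mul_le_of_zero (fun x y => hh (i + e * x) (i + e * y))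
    (comp_affine (by simpa using h₁)) (j := e * (j - i)) ?_
  obtain rfl | rfl := he
  · exact h₂.imp comp_affine comp_affine
  · exact h₂.symm.imp comp_affine comp_affine

end IsAscent

theorem IsCircularColoring.isSunColoring {V : Type*} {G : SimpleGraph V} {k d : ℕ}
    {f : G.edgeSet → Fin k} (hf : IsCircularColoring G.lineGraph k d f) {e : Fin 5} (he : e ≠ 0)
    {v w : Fin 5 → V} (hv : v.Injective) (hvw : ∀ i j, v i ≠ w j)
    (hrim : ∀ i, G.Adj (v i) (v (i + e))) (hspoke : ∀ i, G.Adj (v i) (w i))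
    (hlt : ∀ i, (f ⟨s(v i, w i), hspoke i⟩ : ℕ) < d) :
    IsSunColoring k d e (fun i => (f ⟨s(v i, w i), hspoke i⟩ : ℕ))
      fun i => (f ⟨s(v i, v (i + e)), hrim i⟩ : ℕ) where
  left_mem i := hf.val_mem_Icc_of_val_lt (lineGraph_adj_of_ne _ _ (hvw _ _).symm) (hlt i)
  right_mem i := by
    refine hf.val_mem_Icc_of_val_lt ?_ (hlt (i + e))
    simpa only [Sym2.eq_swap] using
      lineGraph_adj_of_ne (hspoke (i + e)) (hrim i).symm (hvw _ _).symm
  le_abs_sub i := by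
    have hindex : ∀ i e : Fin 5, e ≠ 0 → i ≠ i + e + e := by decide
    have hne : v i ≠ v (i + e + e) := fun h => hindex i e he (hv h)
    refine (hf _ _ ?_).1
    simpa only [Sym2.eq_swap] using lineGraph_adj_of_ne (hrim i).symm (hrim (i + e)) hne

instance : DecidableRel petersenGraph.Adj := fun s t =>
  inferInstanceAs (Decidable (Disjoint s.1 t.1))

/-- The vertices of the inner 5-cycle in a drawing of the Petersen graph as two 5-cycles joined by
spokes, labelled so that `innerVertex i` is adjacent to `innerVertex (i ± 1)`. -/
def innerVertex (i : Fin 5) : {s : Finset (Fin 5) // s.card = 2} :=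
  ⟨{i + 1, i - 1}, by decide +revert⟩

/-- The vertices of the other 5-cycle: `outerVertex i` is adjacent to `innerVertex i` and to
`outerVertex (i ± 2)`. -/
def outerVertex (i : Fin 5) : {s : Finset (Fin 5) // s.card = 2} :=
  ⟨{i + 2, i - 2}, by decide +revert⟩

theorem adj_innerVertex_iff : ∀ {i v}, petersenGraph.Adj (innerVertex i) v ↔
    v = innerVertex (i + 1) ∨ v = innerVertex (i - 1) ∨ v = outerVertex i := by
  decide

theorem adj_outerVertex_iff : ∀ {i v}, petersenGraph.Adj (outerVertex i) v ↔
    v = outerVertex (i + 2) ∨ v = outerVertex (i - 2) ∨ v = innerVertex i := by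
  decide

theorem innerVertex_injective : innerVertex.Injective := by
  decide

theorem outerVertex_injective : outerVertex.Injective := by
  decide

theorem innerVertex_ne_outerVertex : ∀ i j, innerVertex i ≠ outerVertex j := by
  decide

/-- The automorphism of the Petersen graph induced by a permutation of the 5-element set. -/
def petersenAut (σ : Equiv.Perm (Fin 5)) : petersenGraph ≃g petersenGraph where
  toEquiv := σ.finsetCongr.subtypeEquiv fun s => by simp
  map_rel_iff' {s t} := by
    simp [petersenGraph]

set_option synthInstance.maxSize 2000 in
theorem exists_petersenAut_threeArc : ∀ a b, petersenGraph.Adj a b →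
    ∀ c, petersenGraph.Adj b c → a ≠ c → ∀ d, petersenGraph.Adj c d → b ≠ d →
    ∃ σ, petersenAut σ (outerVertex 0) = a ∧ petersenAut σ (innerVertex 0) = b ∧
      petersenAut σ (innerVertex 1) = c ∧ petersenAut σ (outerVertex 1) = d := by
  decide +kernel

section PerfectMatching

variable {m : {s : Finset (Fin 5) // s.card = 2} → {s : Finset (Fin 5) // s.card = 2}}
  {i : Fin 5}

theorem map_outerVertex_eq_innerVertex (hm : m.Involutive)
    (hadj : ∀ v, petersenGraph.Adj v (m v)) (hadd : m (innerVertex (i + 2)) = outerVertex (i + 2))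
    (hsub : m (innerVertex (i - 2)) = outerVertex (i - 2)) :
    m (outerVertex i) = innerVertex i := by
  obtain h | h | h := adj_outerVertex_iff.1 (hadj (outerVertex i))
  · rw [← hadd, hm.injective.eq_iff] at h
    exact (innerVertex_ne_outerVertex _ _ h.symm).elim
  · rw [← hsub, hm.injective.eq_iff] at h
    exact (innerVertex_ne_outerVertex _ _ h.symm).elim
  · exact h

theorem map_innerVertex_eq_outerVertex (hm : m.Involutive)
    (hadj : ∀ v, petersenGraph.Adj v (m v)) (hadd : m (outerVertex (i + 1)) = innerVertex (i + 1))
    (hsub : m (outerVertex (i - 1)) = innerVertex (i - 1)) :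
    m (innerVertex i) = outerVertex i := by
  obtain h | h | h := adj_innerVertex_iff.1 (hadj (innerVertex i))
  · rw [← hadd, hm.injective.eq_iff] at h
    exact (innerVertex_ne_outerVertex _ _ h).elim
  · rw [← hsub, hm.injective.eq_iff] at h
    exact (innerVertex_ne_outerVertex _ _ h).elim
  · exact h

theorem map_innerVertex_eq_outerVertex_of_zero_one (hm : m.Involutive)
    (hadj : ∀ v, petersenGraph.Adj v (m v)) (h₀ : m (innerVertex 0) = outerVertex 0)
    (h₁ : m (innerVertex 1) = outerVertex 1) : m (innerVertex i) = outerVertex i := by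
  have h₀' : m (outerVertex 0) = innerVertex 0 := (hm.eq_iff.1 h₀).symm
  have h₁' : m (outerVertex 1) = innerVertex 1 := (hm.eq_iff.1 h₁).symm
  have h₃' : m (outerVertex 3) = innerVertex 3 := map_outerVertex_eq_innerVertex hm hadj h₀ h₁
  have h₃ : m (innerVertex 3) = outerVertex 3 := (hm.eq_iff.1 h₃').symm
  have h₂ : m (innerVertex 2) = outerVertex 2 := map_innerVertex_eq_outerVertex hm hadj h₃' h₁'
  have h₄ : m (innerVertex 4) = outerVertex 4 := map_innerVertex_eq_outerVertex hm hadj h₀' h₃'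
  fin_cases i <;> assumption

theorem exists_iso_map_innerVertex (hm : m.Involutive) (hadj : ∀ v, petersenGraph.Adj v (m v)) :
    ∃ φ : petersenGraph ≃g petersenGraph, ∀ i, m (φ (innerVertex i)) = φ (outerVertex i) := by
  obtain ⟨c, hbc, hca⟩ : ∃ c, petersenGraph.Adj (innerVertex 0) c ∧ m (innerVertex 0) ≠ c := by
    by_contra! h
    have h₁ := h (innerVertex 1) (adj_innerVertex_iff.2 (.inl rfl))
    have h₂ := h (outerVertex 0) (adj_innerVertex_iff.2 (.inr (.inr rfl)))
    exact innerVertex_ne_outerVertex _ _ (h₁.symm.trans h₂)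
  have hne : innerVertex 0 ≠ m c := fun h => hca (hm.eq_iff.1 h.symm).symm
  obtain ⟨σ, ha, hb, hc, hd⟩ := exists_petersenAut_threeArc _ _ (hadj (innerVertex 0)).symm
    c hbc hca _ (hadj c) hne
  let φ := petersenAut σ
  have hconj (v w) : φ.symm (m (φ v)) = w ↔ m (φ v) = φ w := φ.toEquiv.symm_apply_eq
  refine ⟨φ, fun i => (hconj _ _).1 ?_⟩
  refine map_innerVertex_eq_outerVertex_of_zero_one (m := fun v => φ.symm (m (φ v))) (fun v => ?_)
    (fun v => ?_) ((hconj _ _).2 ?_) ((hconj _ _).2 ?_)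
  · simp [hm (φ v)]
  · rw [← φ.map_adj_iff, φ.apply_symm_apply]
    exact hadj _
  · rw [hb, ha]
  · rw [hc, hd]

end PerfectMatching

theorem card_edgeSet_petersenGraph : Fintype.card petersenGraph.edgeSet = 15 := by
  decide

namespace IsCircularColoring

variable {k d : ℕ} {f : petersenGraph.edgeSet → Fin k}

theorem exists_iso_spoke_val_lt (hf : IsCircularColoring petersenGraph.lineGraph k d f)
    (hcard : 5 ≤ #{e | (f e : ℕ) < d}) :
    ∃ φ : petersenGraph ≃g petersenGraph, ∀ i,
      ∃ h : petersenGraph.Adj (φ (innerVertex i)) (φ (outerVertex i)),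
        (f ⟨s(φ (innerVertex i), φ (outerVertex i)), h⟩ : ℕ) < d := by
  have hindep : petersenGraph.lineGraph.IsIndepSet
      (({e | (f e : ℕ) < d} : Finset _) : Set petersenGraph.edgeSet) := by
    simpa using hf.isIndepSet_val_lt
  have hvertices : Fintype.card {s : Finset (Fin 5) // s.card = 2} = 10 := by decide
  obtain ⟨m, hm, hmem⟩ := exists_involutive_of_isIndepSet_lineGraph hindep (by omega)
  obtain ⟨φ, hφ⟩ := exists_iso_map_innerVertex hm fun v => (hmem v).1
  refine ⟨φ, fun i => ?_⟩
  rw [← hφ]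
  simpa using hmem (φ (innerVertex i))

theorem eleven_mul_le_of_spoke_val_lt (hf : IsCircularColoring petersenGraph.lineGraph k d f)
    (φ : petersenGraph ≃g petersenGraph)
    (hφ : ∀ i, ∃ h : petersenGraph.Adj (φ (innerVertex i)) (φ (outerVertex i)),
      (f ⟨s(φ (innerVertex i), φ (outerVertex i)), h⟩ : ℕ) < d) :
    11 * d ≤ 3 * k := by
  by_contra! hk
  choose hspoke hlt using hφ
  have hinner := hf.isSunColoring (e := 1) (by decide) (φ.injective.comp innerVertex_injective)
    (fun i j => φ.injective.ne (innerVertex_ne_outerVertex i j))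
    (fun i => φ.map_adj_iff.2 (adj_innerVertex_iff.2 (.inl rfl))) hspoke hlt
  have houter := hf.isSunColoring (e := 2) (by decide) (φ.injective.comp outerVertex_injective)
    (fun i j => φ.injective.ne (innerVertex_ne_outerVertex j i).symm)
    (fun i => φ.map_adj_iff.2 (adj_outerVertex_iff.2 (.inl rfl))) (fun i => (hspoke i).symm)
    (by simpa only [Function.comp_apply, Sym2.eq_swap] using hlt)
  have hspan (i j : Fin 5) :
      ((f ⟨s(φ (innerVertex i), φ (outerVertex i)), hspoke i⟩ : ℕ) : ℤ) <
        (f ⟨s(φ (innerVertex j), φ (outerVertex j)), hspoke j⟩ : ℕ) + d := by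
    have := hlt i
    omega
  obtain ⟨i, hi⟩ := hinner.exists_isAscent (by omega) hspan
  obtain ⟨j, hj⟩ := houter.exists_isAscent (by omega)
    (by simpa only [Function.comp_apply, Sym2.eq_swap] using hspan)
  have := IsAscent.three_mul_le hspan hi
    (by simpa only [Function.comp_apply, Sym2.eq_swap] using hj)
  omega

theorem eleven_mul_le (hf : IsCircularColoring petersenGraph.lineGraph k d f) (hdk : d ≤ k) :
    11 * d ≤ 3 * k := by
  by_contra! hlt
  have : NeZero k := ⟨by omega⟩
  obtain ⟨c, hc⟩ := exists_card_mul_le_mul_card_add_val_lt hdk f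
  rw [card_edgeSet_petersenGraph] at hc
  have hcard : 5 ≤ #{e | ((f e + c : Fin k) : ℕ) < d} := by
    by_contra! hcard
    have := Nat.mul_le_mul_left k (Nat.le_of_lt_succ hcard)
    omega
  obtain ⟨φ, hφ⟩ := (hf.add_right c).exists_iso_spoke_val_lt hcard
  exact hlt.not_ge ((hf.add_right c).eleven_mul_le_of_spoke_val_lt φ hφ)

end IsCircularColoring

/-- The edges of the Petersen graph in three families: the spokes, the inner 5-cycle and the outer
5-cycle. -/
def petersenEdge : Fin 3 × Fin 5 → petersenGraph.edgeSet
  | (0, i) => ⟨s(innerVertex i, outerVertex i), adj_innerVertex_iff.2 (by simp)⟩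
  | (1, i) => ⟨s(innerVertex i, innerVertex (i + 1)), adj_innerVertex_iff.2 (by simp)⟩
  | (2, i) => ⟨s(outerVertex i, outerVertex (i + 2)), adj_outerVertex_iff.2 (by simp)⟩

theorem petersenEdge_bijective : petersenEdge.Bijective := by
  constructor <;> decide

/-- An `(11, 3)`-coloring of the edges of the Petersen graph, indexed as in `petersenEdge`. -/
def petersenColor : Fin 3 × Fin 5 → Fin 11 := fun x =>
  ![![0, 0, 2, 1, 2], ![3, 6, 9, 5, 8], ![5, 4, 10, 8, 7]] x.1 x.2

theorem petersenColor_spec : ∀ x y,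
    petersenGraph.lineGraph.Adj (petersenEdge x) (petersenEdge y) →
    3 ≤ |((petersenColor x : ℕ) : ℤ) - (petersenColor y : ℕ)| ∧
      |((petersenColor x : ℕ) : ℤ) - (petersenColor y : ℕ)| ≤ 8 := by
  simp only [SimpleGraph.lineGraph_adj_iff_exists]
  decide

theorem exists_isCircularColoring_eleven_three :
    ∃ f, IsCircularColoring petersenGraph.lineGraph 11 3 f := by
  refine ⟨petersenColor ∘ (Equiv.ofBijective _ petersenEdge_bijective).symm, ?_⟩
  rw [IsCircularColoring, (Equiv.ofBijective _ petersenEdge_bijective).surjective.forall₂]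
  simpa using petersenColor_spec

theorem mainTheorem6 : circularChromaticNumber petersenGraph.lineGraph = 11 / 3 := by
  refine IsLeast.csInf_eq ⟨⟨11, 3, by norm_num, by norm_num,
    exists_isCircularColoring_eleven_three, by norm_num⟩, ?_⟩
  rintro r ⟨k, d, hd, hk, ⟨f, hf⟩, rfl⟩
  rw [div_le_div_iff₀ (by norm_num) (by exact_mod_cast hd), mul_comm (k : ℝ)]
  exact_mod_cast hf.eleven_mul_le (by omega)
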